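/- Let $N\ge 0$, let $P$ be a partial order on $[N]=\{1,\dots,N\}$, and let $\mathcal U=\mathbb Q\langle u_1,\dots,u_N\rangle$ be the free associative algebra. For $k\ge 1$ put $$\mathfrak e^P_k(\mathbf u)=\sum_{i_1>_P\cdots>_P i_k}u_{i_1}\cdots u_{i_k},$$ define $\mathfrak h^P_0=1$ and recursively $\mathfrak h^P_k=\sum_{i=1}^{k}(-1)^{i-1}\mathfrak e^P_i\,\mathfrak h^P_{k-i}$, and let $$\Omega^P(\mathbf x,\mathbf u)=H^P(x_1,\mathbf u)\,H^P(x_2,\mathbf u)\cdots\in\mathcal U[[x_1,x_2,\dots]],\qquad H^P(x,\mathbf u)=\sum_{\ell\ge 0}x^\ell\,\mathfrak h^P_\ell(\mathbf u),$$ where the commuting variables $x_i$ also commute with the $u_j$. Let $I$ be a two-sided ideal of $\mathcal U$ satisfying the $P$-commutation relation: $\mathfrak e^P_k\mathfrak e^P_\ell\equiv\mathfrak e^P_\ell\mathfrak e^P_k \pmod I$ for all $k,\ell\ge 1$. Let $\mathrm{Sym}$ be the algebra of symmetric functions over $\mathbb Q$ in $x_1,x_2,\dots$, and let $\phi^P:\mathrm{Sym}\to\mathcal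 U/I$ be the $\mathbb Q$-algebra homomorphism with $\phi^P(e_k)=\mathfrak e^P_k(\mathbf u)$ for $k\ge1$, where $e_k$ is the elementary symmetric function. Let $K$ be a commutative $\mathbb Q$-algebra (for example $\mathbb Q$ or $\mathbb Q[q]$), and let $\gamma=\sum_{\mathsf w}\gamma_{\mathsf w}\mathsf w$ be a finite linear combination, with coefficients in $K$, of words on $[N]$. Write $\langle\cdot,\gamma\rangle$ for the $\mathbb Q$-linear map $\mathcal U\to K$ sending the monomial $u_{\mathsf w}$ to $\gamma_{\mathsf w}$, extended coefficientwise to $\mathcal U[[\mathbf x]]\to K[[\mathbf x]]$. Assume that $\gamma\in I^\perp$, that is, $\langle z,\gamma\rangle=0$ for all $z\in I$, and put $F^P_\gamma(\mathbf x)=\langle\Omega^P(\mathbf x,\mathbf u),\gamma\rangle$. Then $F^P_\gamma(\mathbf x)$ is a symmetric function with coefficients in $K$, and for every $f\in\mathrm{Sym}$ and every $\mathfrak f^P(\mathbf u)\in\mathcal U$ whose class in $\mathcal U/I$ is $\phi^P(f)$, $$f^\perp F^P_\gamma(\mathbf x)=\langle \mathfrak f^P(\mathbf u)\,\Omega^P(\mathbf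 x,\mathbf u),\gamma\rangle .$$ Here $f^\perp$ is the skewing operator on symmetric functions with coefficients in $K$: $f^\perp F$ is the unique symmetric function with $\langle f^\perp F,g\rangle=\langle F,fg\rangle$ for all symmetric functions $g$ with coefficients in $K$, where $\langle\cdot,\cdot\rangle$ is the $K$-bilinear Hall inner product, for which the monomial symmetric functions $m_\lambda$ and the complete homogeneous symmetric functions $h_\lambda$ are dual bases. -/

import Mathlib

noncomputable section

namespace NCSym

open Finset

/-- A formal power series in `x_0, x_1, x_2, …` is symmetric if it is invariant under
every permutation of the variables. -/
def IsSymm {R : Type*} [CommRing R] (f : MvPowerSeries ℕ R) : Prop :=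
  ∀ σ : Equiv.Perm ℕ, MvPowerSeries.rename σ f = f

/-- The degrees of the monomials of `f` are bounded. -/
def HasBoundedDegree {R : Type*} [CommRing R] (f : MvPowerSeries ℕ R) : Prop :=
  ∃ n : ℕ, ∀ d : ℕ →₀ ℕ, n < d.degree → MvPowerSeries.coeff d f = 0

theorem hasBoundedDegree_algebraMap {R : Type*} [CommRing R] (r : R) :
    HasBoundedDegree (algebraMap R (MvPowerSeries ℕ R) r) := by
  classical
  refine ⟨0, fun d hd => ?_⟩
  rw [MvPowerSeries.algebraMap_apply, Algebra.algebraMap_self, RingHom.id_apply,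
    MvPowerSeries.coeff_C, if_neg]
  rintro rfl
  simp at hd

theorem HasBoundedDegree.add {R : Type*} [CommRing R] {f g : MvPowerSeries ℕ R}
    (hf : HasBoundedDegree f) (hg : HasBoundedDegree g) : HasBoundedDegree (f + g) := by
  obtain ⟨m, hm⟩ := hf
  obtain ⟨n, hn⟩ := hg
  refine ⟨max m n, fun d hd => ?_⟩
  rw [map_add, hm d (lt_of_le_of_lt (le_max_left _ _) hd),
    hn d (lt_of_le_of_lt (le_max_right _ _) hd), add_zero]

theorem HasBoundedDegree.mul {R : Type*} [CommRing R] {f g : MvPowerSeries ℕ R}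
    (hf : HasBoundedDegree f) (hg : HasBoundedDegree g) : HasBoundedDegree (f * g) := by
  classical
  obtain ⟨m, hm⟩ := hf
  obtain ⟨n, hn⟩ := hg
  refine ⟨m + n, fun d hd => ?_⟩
  rw [MvPowerSeries.coeff_mul]
  refine Finset.sum_eq_zero fun p hp => ?_
  rw [HasAntidiagonal.mem_antidiagonal] at hp
  have : p.1.degree + p.2.degree = d.degree := by rw [← hp, map_add]
  by_cases h : m < p.1.degree
  · rw [hm _ h, zero_mul]
  · rw [hn _ (by omega), mul_zero]

/-- The algebra of symmetric functions in `x_0, x_1, x_2, …` with coefficients in `R`: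
symmetric formal power series of bounded degree. -/
def Sym (R : Type*) [CommRing R] : Subalgebra R (MvPowerSeries ℕ R) where
  carrier := {f | IsSymm f ∧ HasBoundedDegree f}
  mul_mem' hf hg := ⟨fun σ => by rw [map_mul, hf.1 σ, hg.1 σ], hf.2.mul hg.2⟩
  add_mem' hf hg := ⟨fun σ => by rw [map_add, hf.1 σ, hg.1 σ], hf.2.add hg.2⟩
  algebraMap_mem' r := ⟨fun σ => AlgHom.commutes _ r, hasBoundedDegree_algebraMap r⟩

theorem isSymm_iff {R : Type*} [CommRing R] (f : MvPowerSeries ℕ R) :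
    IsSymm f ↔ ∀ (σ : Equiv.Perm ℕ) (d : ℕ →₀ ℕ),
      MvPowerSeries.coeff (Finsupp.embDomain σ.toEmbedding d) f = MvPowerSeries.coeff d f := by
  have key : ∀ (σ : Equiv.Perm ℕ) (d : ℕ →₀ ℕ), MvPowerSeries.coeff
      (Finsupp.embDomain σ.toEmbedding d) (MvPowerSeries.rename σ f) =
        MvPowerSeries.coeff d f :=
    fun σ d => MvPowerSeries.coeff_embDomain_rename σ.toEmbedding f d
  constructor
  · intro h σ d
    conv_lhs => rw [← h σ]
    exact key σ d
  · intro h σ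
    ext d
    obtain ⟨c, rfl⟩ : ∃ c, Finsupp.embDomain σ.toEmbedding c = d :=
      ⟨Finsupp.embDomain σ.symm.toEmbedding d, by
        ext i
        obtain ⟨j, rfl⟩ := σ.surjective i
        have := Finsupp.embDomain_apply_self σ.toEmbedding
          (Finsupp.embDomain σ.symm.toEmbedding d) j
        rw [Equiv.coe_toEmbedding] at this
        rw [this]
        have := Finsupp.embDomain_apply_self σ.symm.toEmbedding d (σ j)
        rw [Equiv.coe_toEmbedding, Equiv.symm_apply_apply] at this
        exact this⟩
    rw [key, h]

theorem degree_embDomain (e : ℕ ↪ ℕ) (d : ℕ →₀ ℕ) : (Finsupp.embDomain e d).degree = d.degree := by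
  rw [Finsupp.degree_apply, Finsupp.degree_apply, Finsupp.support_embDomain, Finset.sum_map]
  exact Finset.sum_congr rfl fun i _ => Finsupp.embDomain_apply_self e d i

/-- The elementary symmetric function `e_k`: the sum of all squarefree monomials of degree `k`. -/
def esymm (R : Type*) [CommRing R] (k : ℕ) : Sym R :=
  ⟨fun d => open Classical in if (∀ i, d i ≤ 1) ∧ d.degree = k then 1 else 0, by
    constructor
    · refine (isSymm_iff _).2 ?_
      intro σ d
      refine @if_congr _ _ _ (_) (_) _ _ _ _ ?_ rfl rfl
      rw [degree_embDomain]
      refine and_congr_left fun _ => ?_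
      rw [σ.surjective.forall]
      exact forall_congr' fun i => by
        rw [show (Finsupp.embDomain σ.toEmbedding d) (σ i) = d i from
          Finsupp.embDomain_apply_self σ.toEmbedding d i]
    · exact ⟨k, fun d hd => if_neg fun h => by omega⟩⟩

/-- The complete homogeneous symmetric function `h_k`: the sum of all monomials of degree `k`. -/
def hsymm (R : Type*) [CommRing R] (k : ℕ) : Sym R :=
  ⟨fun d => if d.degree = k then 1 else 0, by
    constructor
    · refine (isSymm_iff _).2 ?_
      intro σ d
      exact if_congr (by rw [degree_embDomain]) rfl rfl
    · exact ⟨k, fun d hd => if_neg fun h => by omega⟩⟩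

open Classical in
theorem coeff_esymm {R : Type*} [CommRing R] (k : ℕ) (d : ℕ →₀ ℕ) :
    MvPowerSeries.coeff d (esymm R k : MvPowerSeries ℕ R) =
      if (∀ i, d i ≤ 1) ∧ d.degree = k then 1 else 0 := rfl

theorem coeff_hsymm {R : Type*} [CommRing R] (k : ℕ) (d : ℕ →₀ ℕ) :
    MvPowerSeries.coeff d (hsymm R k : MvPowerSeries ℕ R) =
      if d.degree = k then 1 else 0 := rfl

/-- The algebra map from the polynomial ring sending the variable `X_k` to `e_{k+1}`. -/
def esymmHom (R : Type*) [CommRing R] : MvPolynomial ℕ R →ₐ[R] Sym R :=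
  MvPolynomial.aeval fun k => esymm R (k + 1)

theorem killCompl_esymm {R : Type*} [CommRing R] (n k : ℕ) :
    MvPowerSeries.killCompl (Fin.valEmbedding : Fin n ↪ ℕ) (esymm R k : MvPowerSeries ℕ R) =
      (MvPolynomial.esymm (Fin n) R k : MvPowerSeries (Fin n) R) := by
  classical
  ext d
  rw [MvPowerSeries.coeff_killCompl, coeff_esymm, MvPolynomial.coeff_coe,
    MvPolynomial.esymm_eq_sum_monomial, MvPolynomial.coeff_sum]
  simp only [MvPolynomial.coeff_monomial]
  have hdeg : (Finsupp.embDomain (Fin.valEmbedding : Fin n ↪ ℕ) d).degree = d.degree := by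
    rw [Finsupp.degree_apply, Finsupp.degree_apply, Finsupp.support_embDomain, Finset.sum_map]
    exact Finset.sum_congr rfl fun i _ => Finsupp.embDomain_apply_self _ d i
  have hle : (∀ i, (Finsupp.embDomain (Fin.valEmbedding : Fin n ↪ ℕ) d) i ≤ 1) ↔
      ∀ i, d i ≤ 1 := by
    constructor
    · intro h i
      have := h (Fin.valEmbedding i)
      rwa [Finsupp.embDomain_apply_self] at this
    · intro h i
      by_cases hi : i ∈ Set.range (Fin.valEmbedding : Fin n ↪ ℕ)
      · obtain ⟨j, rfl⟩ := hi
        rw [Finsupp.embDomain_apply_self]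
        exact h j
      · rw [Finsupp.embDomain_of_notMem_range _ _ _ hi]
        omega
  rw [hdeg]
  have hs : ∀ t : Finset (Fin n), ∀ i, (∑ j ∈ t, Finsupp.single j 1 : Fin n →₀ ℕ) i =
      if i ∈ t then 1 else 0 := by
    intro t i
    simp [Finsupp.finsetSum_apply, Finsupp.single_apply]
  by_cases h : (∀ i, d i ≤ 1) ∧ d.degree = k
  · rw [if_pos ⟨hle.2 h.1, h.2⟩]
    have hd : ∑ j ∈ d.support, Finsupp.single j 1 = d := by
      ext i
      rw [hs]
      have := h.1 i
      split_ifs with hi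
      · rw [Finsupp.mem_support_iff] at hi; omega
      · rw [Finsupp.notMem_support_iff] at hi; omega
    rw [Finset.sum_eq_single d.support]
    · rw [if_pos hd]
    · intro t _ ht
      rw [if_neg]
      intro h'
      apply ht
      ext i
      rw [Finsupp.mem_support_iff, ← h', hs]
      split_ifs with hi <;> simp [hi]
    · intro h'
      exfalso
      apply h'
      rw [mem_powersetCard]
      refine ⟨subset_univ _, ?_⟩
      rw [← h.2, Finsupp.degree_apply, Finset.card_eq_sum_ones]
      refine Finset.sum_congr rfl fun i hi => ?_
      have := h.1 i
      rw [Finsupp.mem_support_iff] at hi; omega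
  · rw [if_neg (by rw [hle]; exact h)]
    symm
    refine Finset.sum_eq_zero fun t ht => if_neg ?_
    rintro rfl
    apply h
    constructor
    · intro i
      rw [hs]; split_ifs <;> omega
    · rw [map_sum]
      simp only [Finsupp.degree_single, Finset.sum_const, smul_eq_mul, mul_one]
      exact (mem_powersetCard.1 ht).2

theorem killCompl_esymmHom {R : Type*} [CommRing R] (n : ℕ) (p : MvPolynomial (Fin n) R) :
    MvPowerSeries.killCompl (Fin.valEmbedding : Fin n ↪ ℕ)
        (esymmHom R (MvPolynomial.rename Fin.val p) : MvPowerSeries ℕ R) =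
      ((MvPolynomial.esymmAlgHom (Fin n) R n p : MvPolynomial (Fin n) R) :
        MvPowerSeries (Fin n) R) := by
  have : ((MvPowerSeries.killCompl (Fin.valEmbedding : Fin n ↪ ℕ)).comp
      ((Sym R).val.comp ((esymmHom R).comp (MvPolynomial.rename Fin.val)))) =
      (MvPolynomial.coeToMvPowerSeries.algHom R).comp
        ((Subalgebra.val _).comp (MvPolynomial.esymmAlgHom (Fin n) R n)) := by
    ext1 i
    simp [esymmHom, MvPolynomial.esymmAlgHom, killCompl_esymm]
  have h := DFunLike.congr_fun this p
  simpa using h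

theorem esymmHom_injective (R : Type*) [CommRing R] : Function.Injective (esymmHom R) := by
  rw [injective_iff_map_eq_zero]
  intro p hp
  obtain ⟨n, hn⟩ : ∃ n, ∀ i ∈ p.vars, i < n :=
    ⟨p.vars.sup id + 1, fun i hi => Nat.lt_succ_of_le (Finset.le_sup (f := id) hi)⟩
  obtain ⟨q, rfl⟩ := MvPolynomial.exists_rename_eq_of_vars_subset_range p
    (Fin.val : Fin n → ℕ) Fin.val_injective (fun i hi => ⟨⟨i, hn i hi⟩, rfl⟩)
  have h := killCompl_esymmHom n q
  rw [hp, ZeroMemClass.coe_zero, map_zero] at h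
  have h2 : MvPolynomial.esymmAlgHom (Fin n) R n q = 0 := by
    apply Subtype.ext
    apply MvPolynomial.coe_injective
    rw [← h]; simp
  have := (injective_iff_map_eq_zero _).1 (MvPolynomial.esymmAlgHom_fin_injective R le_rfl) q h2
  rw [this, map_zero]

theorem isHomogeneous_esymm {R : Type*} [CommRing R] (k : ℕ) :
    (esymm R k : MvPowerSeries ℕ R).IsHomogeneous k := by
  intro d hd
  rw [coeff_esymm] at hd
  by_contra h
  refine hd (if_neg fun h' => h ?_)
  rw [← h'.2, Finsupp.degree_eq_weight_one]; rfl

/-- The weighted degree in which `X_k` has degree `k + 1`. -/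
def wt (s : ℕ →₀ ℕ) : ℕ := s.sum fun k m => m * (k + 1)

theorem isHomogeneous_pow {R : Type*} [CommRing R] {f : MvPowerSeries ℕ R} {k : ℕ}
    (hf : f.IsHomogeneous k) (m : ℕ) : (f ^ m).IsHomogeneous (m * k) := by
  induction m with
  | zero =>
    classical
    intro d hd
    rw [pow_zero, MvPowerSeries.coeff_one] at hd
    have h := (ite_ne_right_iff.1 hd).1
    subst h; simp
  | succ m ih =>
    rw [pow_succ, add_mul, one_mul]
    exact ih.mul hf

theorem isHomogeneous_esymmHom_monomial {R : Type*} [CommRing R] (s : ℕ →₀ ℕ) :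
    (esymmHom R (MvPolynomial.monomial s 1) : MvPowerSeries ℕ R).IsHomogeneous (wt s) := by
  classical
  induction s using Finsupp.induction with
  | zero =>
    intro d hd
    rw [esymmHom, MvPolynomial.aeval_monomial] at hd
    simp only [map_one, Finsupp.prod_zero_index, mul_one, OneMemClass.coe_one] at hd
    rw [MvPowerSeries.coeff_one] at hd
    have h := (ite_ne_right_iff.1 hd).1
    subst h; simp [wt]
  | single_add k m s hk hm ih =>
    have h1 : wt (Finsupp.single k m + s) = m * (k + 1) + wt s := by
      rw [wt, Finsupp.sum_add_index']
      · rw [Finsupp.sum_single_index (by simp), wt]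
      · simp
      · intro a b c; ring
    have h2 : (esymmHom R (MvPolynomial.monomial (Finsupp.single k m + s) 1) :
        MvPowerSeries ℕ R) = (esymm R (k + 1) : MvPowerSeries ℕ R) ^ m *
          (esymmHom R (MvPolynomial.monomial s 1) : MvPowerSeries ℕ R) := by
      rw [← one_mul (1 : R), ← MvPolynomial.monomial_mul, map_mul, MulMemClass.coe_mul, one_mul]
      congr 1
      rw [esymmHom, MvPolynomial.aeval_monomial, map_one, one_mul,
        Finsupp.prod_single_index (by simp), SubmonoidClass.coe_pow]
    rw [h1, h2]
    intro d
    exact MvPowerSeries.IsHomogeneous.mul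
      (isHomogeneous_pow (isHomogeneous_esymm (k + 1)) m) ih

theorem coeff_esymmHom_monomial {R : Type*} [CommRing R] (s d : ℕ →₀ ℕ) (r : R)
    (h : d.degree ≠ wt s) :
    MvPowerSeries.coeff d (esymmHom R (MvPolynomial.monomial s r) : MvPowerSeries ℕ R) = 0 := by
  have : MvPolynomial.monomial s r = r • MvPolynomial.monomial s 1 := by
    rw [MvPolynomial.smul_monomial, smul_eq_mul, mul_one]
  rw [this, map_smul]
  simp [MvPowerSeries.IsHomogeneous.coeff_eq_zero (isHomogeneous_esymmHom_monomial s) h]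

theorem esymmHom_surjective (R : Type*) [CommRing R] : Function.Surjective (esymmHom R) := by
  classical
  rintro ⟨f, hf, n, hn⟩
  -- the truncation of `f` to `n` variables is a symmetric polynomial
  set t := MvPowerSeries.killCompl (Fin.valEmbedding : Fin n ↪ ℕ) f with ht
  have hdeg : ∀ x : Fin n →₀ ℕ,
      (Finsupp.embDomain (Fin.valEmbedding : Fin n ↪ ℕ) x).degree = x.degree := by
    intro d
    rw [Finsupp.degree_apply, Finsupp.degree_apply, Finsupp.support_embDomain, Finset.sum_map]
    exact Finset.sum_congr rfl fun i _ => Finsupp.embDomain_apply_self _ d i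
  obtain ⟨p, hp⟩ : ∃ p : MvPolynomial (Fin n) R, (p : MvPowerSeries (Fin n) R) = t := by
    refine ⟨MvPowerSeries.truncTotal (n + 1) t, ?_⟩
    ext d
    rw [MvPolynomial.coeff_coe]
    by_cases h : d.degree < n + 1
    · rw [MvPowerSeries.coeff_truncTotal _ h]
    · rw [MvPowerSeries.coeff_truncTotal_eq_zero _ (by omega), ht,
        MvPowerSeries.coeff_killCompl, hn]
      rw [hdeg]; omega
  have hcp : ∀ x, MvPolynomial.coeff x p =
      MvPowerSeries.coeff (Finsupp.embDomain (Fin.valEmbedding : Fin n ↪ ℕ) x) f := by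
    intro x
    rw [← MvPolynomial.coeff_coe, hp, ht, MvPowerSeries.coeff_killCompl]
  have hps : p.IsSymmetric := by
    intro e
    ext x
    obtain ⟨y, rfl⟩ : ∃ y, Finsupp.mapDomain e y = x :=
      ⟨Finsupp.mapDomain e.symm x, by rw [← Finsupp.mapDomain_comp]; simp⟩
    rw [MvPolynomial.coeff_rename_mapDomain _ e.injective, hcp, hcp]
    let σ : Equiv.Perm ℕ := e.extendDomain (Fin.equivSubtype (n := n))
    rw [← (isSymm_iff f).1 hf σ]
    congr 2
    rw [Finsupp.embDomain_eq_mapDomain, Finsupp.embDomain_eq_mapDomain,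
      Finsupp.embDomain_eq_mapDomain, ← Finsupp.mapDomain_comp, ← Finsupp.mapDomain_comp]
    congr 1
    funext i
    exact Equiv.Perm.extendDomain_apply_image e (Fin.equivSubtype (n := n)) i
  obtain ⟨q, hq⟩ := (MvPolynomial.esymmAlgHom_fin_bijective R n).2 ⟨p, hps⟩
  set Q := MvPolynomial.rename Fin.val q with hQ
  -- for monomials in the first `n` variables, `Q` computes the coefficients of `f`
  have hQf : ∀ x : Fin n →₀ ℕ, MvPowerSeries.coeff
      (Finsupp.embDomain (Fin.valEmbedding : Fin n ↪ ℕ) x) (esymmHom R Q : MvPowerSeries ℕ R) =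
        MvPowerSeries.coeff (Finsupp.embDomain (Fin.valEmbedding : Fin n ↪ ℕ) x) f := by
    intro x
    rw [← MvPowerSeries.coeff_killCompl, hQ, killCompl_esymmHom, hq, ← hcp,
      MvPolynomial.coeff_coe]
  set Q' : MvPolynomial ℕ R := ∑ s ∈ Q.support with wt s ≤ n,
    MvPolynomial.monomial s (MvPolynomial.coeff s Q) with hQ'
  have hcoe : ∀ (S : Finset (ℕ →₀ ℕ)) (d : ℕ →₀ ℕ), MvPowerSeries.coeff d (esymmHom R
      (∑ s ∈ S, MvPolynomial.monomial s (MvPolynomial.coeff s Q)) : MvPowerSeries ℕ R) =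
      ∑ s ∈ S, MvPowerSeries.coeff d
        (esymmHom R (MvPolynomial.monomial s (MvPolynomial.coeff s Q)) : MvPowerSeries ℕ R) := by
    intro S d
    rw [map_sum, AddSubmonoidClass.coe_finsetSum, map_sum]
  have hlow : ∀ d : ℕ →₀ ℕ, d.degree ≤ n → MvPowerSeries.coeff d
      (esymmHom R Q' : MvPowerSeries ℕ R) = MvPowerSeries.coeff d
        (esymmHom R Q : MvPowerSeries ℕ R) := by
    intro d hd
    conv_rhs => rw [Q.as_sum]
    rw [hQ', hcoe, hcoe, Finset.sum_filter]
    refine Finset.sum_congr rfl fun s _ => ?_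
    split_ifs with h
    · rfl
    · rw [coeff_esymmHom_monomial]; omega
  have hhigh : ∀ d : ℕ →₀ ℕ, n < d.degree → MvPowerSeries.coeff d
      (esymmHom R Q' : MvPowerSeries ℕ R) = 0 := by
    intro d hd
    rw [hQ', hcoe]
    refine Finset.sum_eq_zero fun s hs => ?_
    rw [coeff_esymmHom_monomial]
    have := (Finset.mem_filter.1 hs).2
    omega
  refine ⟨Q', Subtype.ext ?_⟩
  ext d
  by_cases hd : n < d.degree
  · rw [hhigh d hd, hn d hd]
  rw [hlow d (by omega)]
  -- move the support of `d` into the first `n` variables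
  have hcard : d.support.card ≤ n := by
    refine le_trans ?_ (not_lt.1 hd)
    rw [Finsupp.degree_apply, Finset.card_eq_sum_ones]
    exact Finset.sum_le_sum fun i hi => Nat.one_le_iff_ne_zero.2 (Finsupp.mem_support_iff.1 hi)
  obtain ⟨g, hg⟩ : ∃ σ : Equiv.Perm ℕ, ∀ i ∈ d.support, σ i < n := by
    let u : d.support ≃ {i // i ∈ Finset.range d.support.card} :=
      Finset.equivOfCardEq (by simp)
    let u' : {i // i ∈ d.support} ≃ {i // i < d.support.card} :=
      u.trans (Equiv.subtypeEquivRight fun i => Finset.mem_range)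
    obtain ⟨σ, hσ⟩ : ∃ σ : Equiv.Perm ℕ, ∀ i : {i // i ∈ d.support}, σ i = u' i := by
      have : Finite ↑{i | i ∈ d.support} := d.support.finite_toSet
      exact ⟨u'.extendSubtype, fun i => u'.extendSubtype_apply_of_mem i i.2⟩
    exact ⟨σ, fun i hi => by
      have := hσ ⟨i, hi⟩
      simp only at this
      rw [this]; exact lt_of_lt_of_le (u' ⟨i, hi⟩).2 hcard⟩
  rw [← (isSymm_iff f).1 hf g, ← (isSymm_iff _).1 (esymmHom R Q).2.1 g]
  obtain ⟨x, hx⟩ : ∃ x, Finsupp.embDomain (Fin.valEmbedding : Fin n ↪ ℕ) x =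
      Finsupp.embDomain g.toEmbedding d := by
    rw [← Set.mem_range, Finsupp.mem_range_embDomain_iff, Finsupp.support_embDomain]
    intro i hi
    rw [Finset.mem_coe, Finset.mem_map] at hi
    obtain ⟨j, hj, rfl⟩ := hi
    exact ⟨⟨g j, hg j hj⟩, rfl⟩
  rw [← hx, hQf]

/-- `e_1, e_2, …` freely generate the algebra of symmetric functions. -/
def esymmEquiv (R : Type*) [CommRing R] : MvPolynomial ℕ R ≃ₐ[R] Sym R :=
  AlgEquiv.ofBijective (esymmHom R) ⟨esymmHom_injective R, esymmHom_surjective R⟩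

theorem sum_squarefree_sign {R : Type*} [CommRing R] (d : ℕ →₀ ℕ) (hd : d ≠ 0) :
    ∑ p ∈ HasAntidiagonal.antidiagonal d,
      (open Classical in if ∀ i, p.1 i ≤ 1 then (-1 : R) ^ p.1.degree else 0) = 0 := by
  classical
  have h0 : ∑ S ∈ d.support.powerset, (-1 : R) ^ S.card = 0 := by
    have := Finset.sum_powerset_neg_one_pow_card_of_nonempty (x := d.support)
      (Finsupp.support_nonempty_iff.2 hd)
    have h2 := congrArg (Int.cast : ℤ → R) this
    push_cast at h2
    exact h2
  refine Eq.trans ?_ h0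
  rw [← Finset.sum_filter]
  have hs : ∀ S : Finset ℕ, ∀ i, (∑ j ∈ S, Finsupp.single j 1 : ℕ →₀ ℕ) i =
      if i ∈ S then 1 else 0 := by
    intro t i
    simp [Finsupp.finsetSum_apply, Finsupp.single_apply]
  have hsupp : ∀ S : Finset ℕ, (∑ j ∈ S, Finsupp.single j 1 : ℕ →₀ ℕ).support = S := by
    intro S; ext i; rw [Finsupp.mem_support_iff, hs]; simp
  refine Finset.sum_bij' (fun p _ => p.1.support)
    (fun S _ => (∑ j ∈ S, Finsupp.single j 1, d - ∑ j ∈ S, Finsupp.single j 1)) ?_ ?_ ?_ ?_ ?_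
  · rintro ⟨a, b⟩ h
    rw [Finset.mem_filter, HasAntidiagonal.mem_antidiagonal] at h
    rw [Finset.mem_powerset]
    intro i hi
    rw [Finsupp.mem_support_iff] at hi ⊢
    rw [← h.1]
    change a i ≠ 0 at hi
    change a i + b i ≠ 0
    omega
  · intro S hS
    rw [Finset.mem_powerset] at hS
    rw [Finset.mem_filter, HasAntidiagonal.mem_antidiagonal]
    constructor
    · ext i
      simp only [Finsupp.add_apply, Finsupp.tsub_apply]
      rw [hs]
      split_ifs with hi
      · have := Finsupp.mem_support_iff.1 (hS hi); omega
      · omega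
    · intro i
      simp only
      rw [hs]; split_ifs <;> omega
  · rintro ⟨a, b⟩ h
    rw [Finset.mem_filter, HasAntidiagonal.mem_antidiagonal] at h
    have ha : ∑ j ∈ a.support, Finsupp.single j 1 = a := by
      ext i
      rw [hs]
      have := h.2 i
      simp only at this
      split_ifs with hi
      · rw [Finsupp.mem_support_iff] at hi; omega
      · rw [Finsupp.notMem_support_iff] at hi; omega
    simp only
    rw [ha, ← h.1]
    simp
  · intro S _
    exact hsupp S
  · rintro ⟨a, b⟩ h
    rw [Finset.mem_filter] at h
    simp only
    congr 1
    rw [Finsupp.degree_apply, Finset.card_eq_sum_ones]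
    refine Finset.sum_congr rfl fun i hi => ?_
    have := h.2 i
    simp only at this
    rw [Finsupp.mem_support_iff] at hi; omega

theorem sum_antidiagonal_esymm_hsymm {R : Type*} [CommRing R] (n : ℕ) :
    ∑ p ∈ HasAntidiagonal.antidiagonal (n + 1),
      (-1 : Sym R) ^ p.1 * (esymm R p.1 * hsymm R p.2) = 0 := by
  classical
  apply Subtype.ext
  ext d
  rw [AddSubmonoidClass.coe_finsetSum, map_sum, ZeroMemClass.coe_zero, map_zero]
  have hterm : ∀ p : ℕ × ℕ, MvPowerSeries.coeff d
      (((-1 : Sym R) ^ p.1 * (esymm R p.1 * hsymm R p.2) : Sym R) : MvPowerSeries ℕ R) =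
      ∑ q ∈ HasAntidiagonal.antidiagonal d, if (q.1.degree, q.2.degree) = p then
        (if ∀ i, q.1 i ≤ 1 then (-1 : R) ^ q.1.degree else 0) else 0 := by
    intro p
    have : (((-1 : Sym R) ^ p.1 * (esymm R p.1 * hsymm R p.2) : Sym R) : MvPowerSeries ℕ R) =
        ((-1 : R) ^ p.1) • ((esymm R p.1 : MvPowerSeries ℕ R) * hsymm R p.2) := by
      rw [MulMemClass.coe_mul, MulMemClass.coe_mul, Algebra.smul_def]
      simp
    rw [this, MvPowerSeries.coeff_smul, MvPowerSeries.coeff_mul, Finset.mul_sum]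
    refine Finset.sum_congr rfl fun q _ => ?_
    rw [coeff_esymm, coeff_hsymm]
    obtain ⟨i, j⟩ := p
    simp only [Prod.mk.injEq]
    by_cases h1 : q.1.degree = i <;> by_cases h2 : q.2.degree = j <;>
      by_cases h3 : ∀ i, q.1 i ≤ 1 <;> simp [h1, h2, h3]
  simp only [hterm]
  rw [Finset.sum_comm]
  simp only [Finset.sum_ite_eq]
  by_cases hd : d.degree = n + 1
  · have hd0 : d ≠ 0 := by rintro rfl; simp at hd
    refine Eq.trans ?_ (sum_squarefree_sign (R := R) d hd0)
    refine Finset.sum_congr rfl fun q hq => ?_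
    rw [HasAntidiagonal.mem_antidiagonal] at hq
    rw [if_pos]
    rw [HasAntidiagonal.mem_antidiagonal, ← hd, ← hq, map_add]
  · refine Finset.sum_eq_zero fun q hq => ?_
    rw [HasAntidiagonal.mem_antidiagonal] at hq
    rw [if_neg]
    rw [HasAntidiagonal.mem_antidiagonal]
    simp only
    rw [← map_add, hq]; exact hd

theorem hsymm_zero (R : Type*) [CommRing R] : hsymm R 0 = 1 := by
  classical
  apply Subtype.ext
  ext d
  rw [coeff_hsymm, OneMemClass.coe_one, MvPowerSeries.coeff_one]
  exact if_congr (Finsupp.degree_eq_zero_iff d) rfl rfl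

theorem esymm_zero (R : Type*) [CommRing R] : esymm R 0 = 1 := by
  classical
  apply Subtype.ext
  ext d
  rw [coeff_esymm, OneMemClass.coe_one, MvPowerSeries.coeff_one]
  refine if_congr ?_ rfl rfl
  rw [Finsupp.degree_eq_zero_iff]
  constructor
  · exact fun h => h.2
  · rintro rfl; simp

/-- `h_{n+1} = e_1 h_n - e_2 h_{n-1} + ⋯`. -/
theorem hsymm_succ (R : Type*) [CommRing R] (n : ℕ) : hsymm R (n + 1) =
    ∑ i ∈ Finset.range (n + 1), (-1) ^ i * (esymm R (i + 1) * hsymm R (n - i)) := by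
  have h := sum_antidiagonal_esymm_hsymm (R := R) n
  rw [Finset.Nat.sum_antidiagonal_eq_sum_range_succ_mk, Finset.sum_range_succ'] at h
  simp only [pow_zero, Nat.sub_zero, esymm_zero, one_mul, Nat.add_sub_add_right] at h
  rw [eq_neg_of_add_eq_zero_right h, ← Finset.sum_neg_distrib]
  refine Finset.sum_congr rfl fun i _ => ?_
  rw [pow_succ]; ring

/-- The polynomial in `e_1 = X_0, e_2 = X_1, …` which gives `h_n`. -/
def hpoly (R : Type*) [CommRing R] : ℕ → MvPolynomial ℕ R
  | 0 => 1
  | n + 1 => ∑ i : Fin (n + 1), (-1) ^ (i : ℕ) * (MvPolynomial.X (i : ℕ) * hpoly R (n - i))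
  decreasing_by omega

theorem hpoly_succ (R : Type*) [CommRing R] (n : ℕ) : hpoly R (n + 1) =
    ∑ i ∈ Finset.range (n + 1), (-1) ^ i * (MvPolynomial.X i * hpoly R (n - i)) := by
  rw [hpoly, Finset.sum_range fun i => (-1) ^ i * (MvPolynomial.X i * hpoly R (n - i))]

theorem esymmHom_hpoly (R : Type*) [CommRing R] (n : ℕ) :
    esymmHom R (hpoly R n) = hsymm R n := by
  induction n using Nat.strong_induction_on with
  | _ n ih =>
    cases n with
    | zero => rw [hpoly, map_one, hsymm_zero]
    | succ n =>
      rw [hpoly_succ, map_sum, hsymm_succ]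
      refine Finset.sum_congr rfl fun i _ => ?_
      rw [map_mul, map_mul, ih (n - i) (by omega), map_pow, map_neg, map_one, esymmHom,
        MvPolynomial.aeval_X]

/-- The endomorphism sending each `e_n` to `h_n`. -/
def omegaHom (R : Type*) [CommRing R] : MvPolynomial ℕ R →ₐ[R] MvPolynomial ℕ R :=
  MvPolynomial.aeval fun k => hpoly R (k + 1)

theorem omegaHom_hpoly (R : Type*) [CommRing R] (n : ℕ) :
    omegaHom R (hpoly R (n + 1)) = MvPolynomial.X n := by
  induction n using Nat.strong_induction_on with
  | _ n ih =>
    have h1 : omegaHom R (hpoly R (n + 1)) = ∑ i ∈ Finset.range (n + 1),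
        (-1) ^ i * (hpoly R (i + 1) * omegaHom R (hpoly R (n - i))) := by
      rw [hpoly_succ, map_sum]
      refine Finset.sum_congr rfl fun i _ => ?_
      rw [map_mul, map_mul, map_pow, map_neg, map_one, omegaHom, MvPolynomial.aeval_X]
    have h2 : ∑ i ∈ Finset.range n, (-1) ^ i * (hpoly R (i + 1) * omegaHom R (hpoly R (n - i))) =
        ∑ i ∈ Finset.range n, (-1) ^ (n - 1 - i) *
          (hpoly R (n - i) * (MvPolynomial.X i : MvPolynomial ℕ R)) := by
      rw [← Finset.sum_range_reflect]
      refine Finset.sum_congr rfl fun i hi => ?_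
      rw [Finset.mem_range] at hi
      rw [show n - (n - 1 - i) = i + 1 by omega, ih i hi, show n - 1 - i + 1 = n - i by omega]
    rw [h1, Finset.sum_range_succ, h2, Nat.sub_self, hpoly_succ, Finset.sum_range_succ,
      Nat.sub_self, hpoly, map_one, mul_one, mul_one, mul_add, ← mul_assoc, ← mul_pow,
      neg_one_mul, neg_neg, one_pow, one_mul, ← add_assoc, Finset.mul_sum,
      ← Finset.sum_add_distrib, Finset.sum_eq_zero, zero_add]
    intro i hi
    rw [Finset.mem_range] at hi
    obtain ⟨m, rfl⟩ : ∃ m, n = i + m + 1 := ⟨n - i - 1, by omega⟩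
    have h3 : ((-1 : MvPolynomial ℕ R) ^ i) * (-1) ^ i = 1 := by
      rw [← mul_pow]; simp
    rw [show i + m + 1 - 1 - i = m by omega, pow_succ, pow_add]
    linear_combination (-1 : MvPolynomial ℕ R) ^ m * (hpoly R (i + m + 1 - i) * MvPolynomial.X i)
      * (-1) * h3

theorem omegaHom_omegaHom (R : Type*) [CommRing R] (p : MvPolynomial ℕ R) :
    omegaHom R (omegaHom R p) = p := by
  have : (omegaHom R).comp (omegaHom R) = AlgHom.id R _ := by
    ext1 k
    rw [AlgHom.comp_apply, omegaHom, MvPolynomial.aeval_X]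
    exact omegaHom_hpoly R k
  exact DFunLike.congr_fun this p

/-- The algebra map from the polynomial ring sending the variable `X_k` to `h_{k+1}`. -/
def hsymmHom (R : Type*) [CommRing R] : MvPolynomial ℕ R →ₐ[R] Sym R :=
  MvPolynomial.aeval fun k => hsymm R (k + 1)

theorem hsymmHom_eq (R : Type*) [CommRing R] (p : MvPolynomial ℕ R) :
    hsymmHom R p = esymmHom R (omegaHom R p) := by
  have : hsymmHom R = (esymmHom R).comp (omegaHom R) := by
    ext1 k
    rw [AlgHom.comp_apply, omegaHom, MvPolynomial.aeval_X, esymmHom_hpoly, hsymmHom,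
      MvPolynomial.aeval_X]
  exact DFunLike.congr_fun this p

theorem hsymmHom_bijective (R : Type*) [CommRing R] : Function.Bijective (hsymmHom R) := by
  constructor
  · intro p q h
    rw [hsymmHom_eq, hsymmHom_eq] at h
    rw [← omegaHom_omegaHom R p, esymmHom_injective R h, omegaHom_omegaHom]
  · intro f
    obtain ⟨p, rfl⟩ := esymmHom_surjective R f
    exact ⟨omegaHom R p, by rw [hsymmHom_eq, omegaHom_omegaHom]⟩

/-- `h_1, h_2, …` freely generate the algebra of symmetric functions. -/
def hsymmEquiv (R : Type*) [CommRing R] : MvPolynomial ℕ R ≃ₐ[R] Sym R :=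
  AlgEquiv.ofBijective (hsymmHom R) (hsymmHom_bijective R)

/-- The partition of the monomial `x^d`: its parts are the nonzero exponents. A partition is
recorded by the multiplicities of its parts, `parts d k` being the number of parts `k + 1`. -/
def parts (d : ℕ →₀ ℕ) : ℕ →₀ ℕ := d.sum fun _ v => Finsupp.single (v - 1) 1

theorem parts_embDomain (e : ℕ ↪ ℕ) (d : ℕ →₀ ℕ) : parts (Finsupp.embDomain e d) = parts d := by
  rw [parts, Finsupp.sum_embDomain, parts]

theorem parts_toFinsupp (l : List ℕ) (hl : ∀ a ∈ l, a ≠ 0) :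
    parts l.toFinsupp = (l.map fun a => Finsupp.single (a - 1) 1).sum := by
  classical
  induction l with
  | nil => simp [parts]
  | cons a l ih =>
    rw [List.toFinsupp_cons_eq_single_add_embDomain, parts,
      Finsupp.sum_add_index_of_disjoint]
    · rw [Finsupp.sum_embDomain, List.map_cons, List.sum_cons,
        ← ih fun b hb => hl b (List.mem_cons_of_mem _ hb)]
      refine congrArg₂ (· + ·) ?_ rfl
      have ha : a ≠ 0 := hl a List.mem_cons_self
      rw [Finsupp.sum, Finsupp.support_single _ ha, Finset.sum_singleton,
        Finsupp.single_eq_same]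
    · rw [Finset.disjoint_left]
      intro i hi hi'
      have h0 := Finset.mem_singleton.1 (Finsupp.support_single_subset hi)
      rw [Finsupp.support_embDomain, Finset.mem_map] at hi'
      obtain ⟨j, _, hj⟩ := hi'
      simp at hj
      omega

/-- The exponent vector `(λ_1, λ_2, …)`, weakly decreasing, of the partition `λ` in which
each part `k + 1` has multiplicity `s k`. -/
def expo (s : ℕ →₀ ℕ) : ℕ →₀ ℕ :=
  ((s.toMultiset.map (· + 1)).sort (· ≥ ·)).toFinsupp

theorem parts_expo (s : ℕ →₀ ℕ) : parts (expo s) = s := by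
  rw [expo, parts_toFinsupp _ (by
    intro a ha
    rw [Multiset.mem_sort, Multiset.mem_map] at ha
    obtain ⟨b, _, rfl⟩ := ha
    omega), ← Multiset.sum_coe, ← Multiset.map_coe, Multiset.sort_eq, Multiset.map_map]
  simp only [Function.comp_def, Nat.add_sub_cancel]
  rw [Finsupp.toMultiset_map, Finsupp.sum_toMultiset,
    Finsupp.sum_mapDomain_index (by simp) (by intros; rw [add_smul])]
  simp

theorem exists_perm_of_parts_eq (d d' : ℕ →₀ ℕ) (h : parts d = parts d') :
    ∃ σ : Equiv.Perm ℕ, Finsupp.embDomain σ.toEmbedding d = d' := by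
  classical
  have hp : ∀ (c : ℕ →₀ ℕ) (v : ℕ), parts c v =
      Fintype.card {i : {i // i ∈ c.support} // c i = v + 1} := by
    intro c v
    rw [parts, Finsupp.sum, Finsupp.finsetSum_apply, Fintype.card_subtype]
    simp only [Finsupp.single_apply]
    rw [← Finset.sum_attach, Finset.sum_boole, Nat.cast_id]
    congr 1
    ext i
    rw [Finset.mem_filter, Finset.mem_filter]
    have := Finsupp.mem_support_iff.1 i.2
    simp only [Finset.mem_attach, Finset.mem_univ, true_and]
    omega
  let u : {i // i ∈ d.support} ≃ {i // i ∈ d'.support} :=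
    Equiv.ofFiberEquiv (f := fun i : {i // i ∈ d.support} => d i)
      (g := fun i : {i // i ∈ d'.support} => d' i) fun v => by
        cases v with
        | zero =>
          have h1 : IsEmpty {i : {i // i ∈ d.support} // d i = 0} :=
            ⟨fun x => Finsupp.mem_support_iff.1 x.1.2 x.2⟩
          have h2 : IsEmpty {i : {i // i ∈ d'.support} // d' i = 0} :=
            ⟨fun x => Finsupp.mem_support_iff.1 x.1.2 x.2⟩
          exact Equiv.equivOfIsEmpty _ _
        | succ v => exact Fintype.equivOfCardEq (by rw [← hp, ← hp, h])
  have hu : ∀ i, d' (u i) = d i := fun i => Equiv.ofFiberEquiv_map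
    (f := fun i : {i // i ∈ d.support} => d i) (g := fun i : {i // i ∈ d'.support} => d' i) _ i
  have : Finite ↑{i | i ∈ d.support} := d.support.finite_toSet
  refine ⟨u.extendSubtype, ?_⟩
  ext i
  obtain ⟨j, rfl⟩ := u.extendSubtype.surjective i
  rw [show Finsupp.embDomain u.extendSubtype.toEmbedding d (u.extendSubtype j) = d j from
    Finsupp.embDomain_apply_self _ d j]
  by_cases hj : j ∈ d.support
  · rw [u.extendSubtype_apply_of_mem j hj, hu]
  · have := u.extendSubtype_not_mem j hj
    rw [Finsupp.notMem_support_iff.1 hj, Finsupp.notMem_support_iff.1 this]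

/-- The basis `h_λ` of the symmetric functions, where `λ` is recorded by the multiplicities
of its parts. -/
def hBasis (R : Type*) [CommRing R] : Module.Basis (ℕ →₀ ℕ) R (Sym R) :=
  (MvPolynomial.basisMonomials ℕ R).map (hsymmEquiv R).toLinearEquiv

/-- `h_λ` is the product of the `h_{λ_i}`. -/
theorem hBasis_apply (R : Type*) [CommRing R] (s : ℕ →₀ ℕ) :
    hBasis R s = s.prod fun k m => hsymm R (k + 1) ^ m := by
  rw [hBasis, Module.Basis.map_apply, MvPolynomial.coe_basisMonomials]
  change hsymmHom R (MvPolynomial.monomial s 1) = _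
  rw [hsymmHom, MvPolynomial.aeval_monomial, map_one, one_mul]

/-- The monomial symmetric function `m_λ`: the sum of all monomials of which the nonzero
exponents are the parts of `λ`. -/
def msymm (R : Type*) [CommRing R] (s : ℕ →₀ ℕ) : Sym R :=
  ⟨fun d => if parts d = s then 1 else 0, by
    constructor
    · refine (isSymm_iff _).2 ?_
      intro σ d
      exact if_congr (by rw [parts_embDomain]) rfl rfl
    · refine ⟨(expo s).degree, fun d hd => if_neg fun h => ?_⟩
      obtain ⟨σ, hσ⟩ := exists_perm_of_parts_eq (expo s) d (by rw [parts_expo, h])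
      rw [← hσ, degree_embDomain] at hd
      exact lt_irrefl _ hd⟩

/-- The Hall inner product: the bilinear pairing for which the bases `m_λ` and `h_λ` are dual.
Since the coefficient of `m_λ` in a symmetric function `f` is the coefficient of `x^λ` in `f`,
this is the pairing which sends `(f, h_λ)` to the coefficient of `x^λ` in `f`. -/
def hall (R : Type*) [CommRing R] : Sym R →ₗ[R] Sym R →ₗ[R] R :=
  ((hBasis R).constr R).toLinearMap ∘ₗ
    LinearMap.pi fun s => MvPowerSeries.coeff (expo s) ∘ₗ (Sym R).val.toLinearMap

theorem hall_hBasis {R : Type*} [CommRing R] (f : Sym R) (s : ℕ →₀ ℕ) :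
    hall R f (hBasis R s) = MvPowerSeries.coeff (expo s) (f : MvPowerSeries ℕ R) := by
  rw [hall, LinearMap.comp_apply, LinearEquiv.coe_coe, Module.Basis.constr_basis]
  rfl

theorem hall_msymm_hBasis {R : Type*} [CommRing R] (s t : ℕ →₀ ℕ) :
    hall R (msymm R s) (hBasis R t) = if s = t then 1 else 0 := by
  rw [hall_hBasis]
  change (if parts (expo t) = s then (1 : R) else 0) = _
  rw [parts_expo]
  exact if_congr eq_comm rfl rfl

/-- The product of the `h_{d i}`. -/
def hProd (R : Type*) [CommRing R] (d : ℕ →₀ ℕ) : Sym R := d.prod fun _ v => hsymm R v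

theorem hProd_eq (R : Type*) [CommRing R] (d : ℕ →₀ ℕ) : hProd R d = hBasis R (parts d) := by
  have h : hBasis R (parts d) = hsymmHom R (MvPolynomial.monomial (parts d) 1) := by
    rw [hBasis, Module.Basis.map_apply, MvPolynomial.coe_basisMonomials]
    rfl
  rw [h, parts, Finsupp.sum, MvPolynomial.monomial_sum_one, map_prod, hProd, Finsupp.prod]
  refine Finset.prod_congr rfl fun i hi => ?_
  have := Finsupp.mem_support_iff.1 hi
  rw [show (MvPolynomial.monomial (Finsupp.single (d i - 1) 1) (1 : R)) =
    MvPolynomial.X (d i - 1) from rfl, hsymmHom, MvPolynomial.aeval_X, Nat.sub_add_cancel]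
  omega

theorem hBasis_mul (R : Type*) [CommRing R] (s t : ℕ →₀ ℕ) :
    hBasis R s * hBasis R t = hBasis R (s + t) := by
  rw [hBasis_apply, hBasis_apply, hBasis_apply, Finsupp.prod_add_index' (by simp)
    (fun k m m' => pow_add _ m m')]

theorem degree_eq_wt_parts (d : ℕ →₀ ℕ) : d.degree = wt (parts d) := by
  rw [parts, Finsupp.sum, wt, ← Finsupp.sum_finsetSum_index (by simp) (by intros; ring),
    Finsupp.degree_apply]
  refine Finset.sum_congr rfl fun i hi => ?_
  have := Finsupp.mem_support_iff.1 hi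
  rw [Finsupp.sum_single_index (by simp)]
  omega

theorem wt_add (s t : ℕ →₀ ℕ) : wt (s + t) = wt s + wt t := by
  rw [wt, Finsupp.sum_add_index' (by simp) (by intros; ring), ← wt, ← wt]

/-- For symmetric functions `a` and `F` there is a unique symmetric function `G` such that
`⟨G, g⟩ = ⟨F, a g⟩` for all symmetric functions `g`. -/
theorem existsUnique_skew {R : Type*} [CommRing R] (a F : Sym R) :
    ∃! G : Sym R, ∀ g : Sym R, hall R G g = hall R F (a * g) := by
  obtain ⟨n, hn⟩ := F.2.2
  have hzero : ∀ d : ℕ →₀ ℕ, n < d.degree → hall R F (a * hProd R d) = 0 := by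
    intro d hd
    have h0 : (hall R F) ∘ₗ (LinearMap.mulRight R (hProd R d)) = 0 := by
      refine (hBasis R).ext fun s => ?_
      rw [LinearMap.comp_apply, LinearMap.mulRight_apply, hProd_eq, hBasis_mul, hall_hBasis,
        LinearMap.zero_apply]
      apply hn
      rw [degree_eq_wt_parts, parts_expo, wt_add, ← degree_eq_wt_parts]
      omega
    exact DFunLike.congr_fun h0 a
  let G : Sym R := ⟨fun d => hall R F (a * hProd R d), by
    constructor
    · refine (isSymm_iff _).2 ?_
      intro σ d
      change hall R F (a * hProd R _) = hall R F (a * hProd R d)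
      rw [hProd_eq, hProd_eq, parts_embDomain]
    · exact ⟨n, hzero⟩⟩
  refine ⟨G, ?_, ?_⟩
  · intro g
    have : hall R G = (hall R F) ∘ₗ (LinearMap.mulLeft R a) := by
      refine (hBasis R).ext fun s => ?_
      rw [hall_hBasis, LinearMap.comp_apply, LinearMap.mulLeft_apply]
      change hall R F (a * hProd R _) = _
      rw [hProd_eq, parts_expo]
    exact DFunLike.congr_fun this g
  · intro G' hG'
    apply Subtype.ext
    ext d
    obtain ⟨σ, hσ⟩ := exists_perm_of_parts_eq d (expo (parts d)) (parts_expo _).symm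
    rw [← (isSymm_iff _).1 G'.2.1 σ, hσ, ← hall_hBasis, hG', ← hProd_eq]
    rfl

/-- The skewing operator: `skew a F`, also written `a^⊥ F`, is the unique symmetric function
such that `⟨a^⊥ F, g⟩ = ⟨F, a g⟩` for all symmetric functions `g`. -/
def skew {R : Type*} [CommRing R] (a F : Sym R) : Sym R := (existsUnique_skew a F).choose

theorem hall_skew {R : Type*} [CommRing R] (a F g : Sym R) :
    hall R (skew a F) g = hall R F (a * g) := (existsUnique_skew a F).choose_spec.1 g

/-- Extension of the coefficients of a symmetric function. -/
def extendCoeff {R : Type*} (S : Type*) [CommRing R] [CommRing S] [Algebra R S] (f : Sym R) :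
    Sym S :=
  ⟨MvPowerSeries.map (algebraMap R S) f, by
    constructor
    · intro σ
      rw [MvPowerSeries.rename_map, f.2.1 σ]
    · obtain ⟨n, hn⟩ := f.2.2
      exact ⟨n, fun d hd => by rw [MvPowerSeries.coeff_map, hn d hd, map_zero]⟩⟩

/-- The free associative `ℚ`-algebra on the noncommuting variables `u_1, …, u_N`. -/
abbrev U (N : ℕ) : Type := FreeAlgebra ℚ (Fin N)

open Classical in
/-- The noncommutative `P`-elementary symmetric function: the sum of the monomials
`u_{i_1} ⋯ u_{i_k}` with `i_1 >_P ⋯ >_P i_k`. -/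
def ncE {N : ℕ} (P : PartialOrder (Fin N)) (k : ℕ) : U N :=
  ∑ w : Fin k → Fin N with ∀ i j : Fin k, i < j → P.lt (w j) (w i),
    (List.ofFn fun i => FreeAlgebra.ι ℚ (w i)).prod

/-- The noncommutative `P`-complete homogeneous symmetric function, defined by
`h_0 = 1` and `h_k = e_1 h_{k-1} - e_2 h_{k-2} + ⋯ + (-1)^{k-1} e_k`. -/
def ncH {N : ℕ} (P : PartialOrder (Fin N)) : ℕ → U N
  | 0 => 1
  | n + 1 => ∑ i : Fin (n + 1), (-1) ^ (i : ℕ) * (ncE P (i + 1) * ncH P (n - i))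
  decreasing_by omega

/-- The series `H^P(x_i, u) = ∑_l x_i^l h_l(u)`, in commuting variables `x_0, x_1, …` which
commute with the `u_j`. -/
def ncHSeries {N : ℕ} (P : PartialOrder (Fin N)) (i : ℕ) : MvPowerSeries ℕ (U N) :=
  fun d => if d = Finsupp.single i (d i) then ncH P (d i) else 0

/-- The finite product `H^P(x_0, u) H^P(x_1, u) ⋯ H^P(x_{n-1}, u)`. -/
def partialOmega {N : ℕ} (P : PartialOrder (Fin N)) (n : ℕ) : MvPowerSeries ℕ (U N) :=
  ((List.range n).map (ncHSeries P)).prod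

/-- The noncommutative `P`-Cauchy product `Ω^P(x, u) = H^P(x_0, u) H^P(x_1, u) ⋯`. The
coefficient of a monomial is its coefficient in any finite product which involves all the
variables of the monomial. -/
def Omega {N : ℕ} (P : PartialOrder (Fin N)) : MvPowerSeries ℕ (U N) :=
  fun d => MvPowerSeries.coeff d (partialOmega P (d.support.sup id + 1))

theorem coeff_partialOmega {N : ℕ} (P : PartialOrder (Fin N)) (n : ℕ) (d : ℕ →₀ ℕ) :
    MvPowerSeries.coeff d (partialOmega P n) =
      if ∀ i ∈ d.support, i < n then ((List.range n).map fun i => ncH P (d i)).prod else 0 := by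
  classical
  induction n generalizing d with
  | zero =>
    rw [partialOmega, List.range_zero, List.map_nil, List.prod_nil, MvPowerSeries.coeff_one]
    refine if_congr ?_ rfl rfl
    constructor
    · rintro rfl; simp
    · intro h
      rw [← Finsupp.support_eq_empty]
      exact Finset.eq_empty_of_forall_notMem fun i hi => by have := h i hi; omega
  | succ n ih =>
    have h1 : partialOmega P (n + 1) = partialOmega P n * ncHSeries P n := by
      rw [partialOmega, List.range_succ, List.map_append, List.prod_append, List.map_singleton,
        List.prod_singleton, ← partialOmega]
    rw [h1, MvPowerSeries.coeff_mul, Finset.sum_eq_single (d.erase n, Finsupp.single n (d n))]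
    · rw [ih]
      have h2 : MvPowerSeries.coeff (Finsupp.single n (d n)) (ncHSeries P n) = ncH P (d n) := by
        change (if _ then _ else _) = _
        rw [if_pos] <;> simp
      simp only
      rw [h2, List.range_succ, List.map_append, List.prod_append, List.map_singleton,
        List.prod_singleton, ite_mul, zero_mul]
      have h3 : (List.range n).map (fun i => ncH P ((d.erase n) i)) =
          (List.range n).map fun i => ncH P (d i) := by
        refine List.map_congr_left fun i hi => ?_
        rw [List.mem_range] at hi
        rw [Finsupp.erase_ne (by omega)]
      rw [h3]
      refine if_congr ?_ rfl rfl
      rw [Finsupp.support_erase]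
      constructor
      · intro h i hi
        by_cases hin : i = n
        · omega
        · have := h i (Finset.mem_erase.2 ⟨hin, hi⟩); omega
      · intro h i hi
        rw [Finset.mem_erase] at hi
        have := h i hi.2; omega
    · rintro ⟨a, b⟩ hab hne
      rw [HasAntidiagonal.mem_antidiagonal] at hab
      simp only at hab ⊢
      by_cases hb : b = Finsupp.single n (b n)
      · rw [ih, if_neg, zero_mul]
        intro h
        apply hne
        have han : a n = 0 := by
          by_contra hn
          exact lt_irrefl _ (h n (Finsupp.mem_support_iff.2 hn))
        have hdn : d n = b n := by rw [← hab, Finsupp.add_apply, han, zero_add]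
        have hb' : b = Finsupp.single n (d n) := by rw [hdn]; exact hb
        rw [← hb']
        congr 1
        ext i
        by_cases hin : i = n
        · subst hin; rw [Finsupp.erase_same, han]
        · rw [Finsupp.erase_ne hin, ← hab, Finsupp.add_apply, hb,
            Finsupp.single_eq_of_ne hin, add_zero]
      · have : MvPowerSeries.coeff b (ncHSeries P n) = 0 := if_neg hb
        rw [this, mul_zero]
    · intro h
      exfalso
      apply h
      rw [HasAntidiagonal.mem_antidiagonal]
      exact Finsupp.erase_add_single n d

theorem coeff_Omega {N : ℕ} (P : PartialOrder (Fin N)) (d : ℕ →₀ ℕ) (n : ℕ)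
    (hn : ∀ i ∈ d.support, i < n) :
    MvPowerSeries.coeff d (Omega P) = MvPowerSeries.coeff d (partialOmega P n) := by
  have hmono : ∀ m k, (∀ i ∈ d.support, i < m) → MvPowerSeries.coeff d (partialOmega P (m + k)) =
      MvPowerSeries.coeff d (partialOmega P m) := by
    intro m k hm
    induction k with
    | zero => rfl
    | succ k ih =>
      rw [← ih, coeff_partialOmega, coeff_partialOmega,
        if_pos fun i hi => by have := hm i hi; omega, if_pos fun i hi => by have := hm i hi; omega,
        ← add_assoc, List.range_succ, List.map_append, List.prod_append, List.map_singleton,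
        List.prod_singleton]
      have : d (m + k) = 0 := by
        by_contra h
        have := hm _ (Finsupp.mem_support_iff.2 h)
        omega
      rw [this, ncH, mul_one]
  have hs : ∀ i ∈ d.support, i < d.support.sup id + 1 := fun i hi =>
    Nat.lt_succ_of_le (Finset.le_sup (f := id) hi)
  change MvPowerSeries.coeff d (partialOmega P (d.support.sup id + 1)) = _
  rcases le_total n (d.support.sup id + 1) with h | h
  · obtain ⟨k, hk⟩ := Nat.exists_eq_add_of_le h
    rw [hk, hmono n k hn]
  · obtain ⟨k, hk⟩ := Nat.exists_eq_add_of_le h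
    rw [hk, hmono _ k hs]

/-- The coefficient in `z` of the monomial `u_w` of a word `w`. -/
def wordCoeff {N : ℕ} (w : FreeMonoid (Fin N)) (z : U N) : ℚ :=
  (FreeAlgebra.equivMonoidAlgebraFreeMonoid z).coeff w

/-- The pairing `⟨z, γ⟩`, where `γ` is a linear combination of words with coefficients in `K`;
it is the bilinear pairing with `⟨u_w, v⟩ = δ_{w,v}` for words `w` and `v`. -/
def pair {N : ℕ} {K : Type*} [CommRing K] [Algebra ℚ K] (z : U N) (γ : FreeMonoid (Fin N) →₀ K) :
    K :=
  γ.sum fun w c => algebraMap ℚ K (wordCoeff w z) * c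

/-- The pairing of a power series with coefficients in `U` with `γ`, coefficient by
coefficient. -/
def pairSeries {N : ℕ} {K : Type*} [CommRing K] [Algebra ℚ K] (Z : MvPowerSeries ℕ (U N))
    (γ : FreeMonoid (Fin N) →₀ K) : MvPowerSeries ℕ K :=
  fun d => pair (MvPowerSeries.coeff d Z) γ

/-- The set `I^⊥` of the `γ` with `⟨z, γ⟩ = 0` for all `z ∈ I`. -/
def perp {N : ℕ} (I : TwoSidedIdeal (U N)) (K : Type*) [CommRing K] [Algebra ℚ K] :
    Set (FreeMonoid (Fin N) →₀ K) :=
  {γ | ∀ z ∈ I, pair z γ = 0}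

/-- `F^P_γ(x) = ⟨Ω^P(x, u), γ⟩`. -/
def FP {N : ℕ} {K : Type*} [CommRing K] [Algebra ℚ K] (P : PartialOrder (Fin N))
    (γ : FreeMonoid (Fin N) →₀ K) : MvPowerSeries ℕ K :=
  pairSeries (Omega P) γ

/-- The `P`-commutation relation `e_k e_l ≡ e_l e_k mod I` for `k, l ≥ 1`. -/
def SatisfiesPCommutation {N : ℕ} (P : PartialOrder (Fin N)) (I : TwoSidedIdeal (U N)) : Prop :=
  ∀ k l : ℕ, 1 ≤ k → 1 ≤ l → ncE P k * ncE P l - ncE P l * ncE P k ∈ I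

theorem exists_phiP {N : ℕ} {P : PartialOrder (Fin N)} {I : TwoSidedIdeal (U N)}
    (hI : SatisfiesPCommutation P I) :
    ∃! φ : Sym ℚ →ₐ[ℚ] I.ringCon.Quotient,
      ∀ k : ℕ, 1 ≤ k → φ (esymm ℚ k) = (ncE P k : I.ringCon.Quotient) := by
  let S : Set I.ringCon.Quotient := Set.range fun k => (ncE P (k + 1) : I.ringCon.Quotient)
  have hS : ∀ a ∈ S, ∀ b ∈ S, a * b = b * a := by
    rintro _ ⟨k, rfl⟩ _ ⟨l, rfl⟩
    simp only
    rw [← RingCon.coe_mul, ← RingCon.coe_mul, RingCon.eq, TwoSidedIdeal.rel_iff]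
    exact hI _ _ (by omega) (by omega)
  have hc : IsMulCommutative (Algebra.adjoin ℚ S) := Algebra.isMulCommutative_adjoin ℚ hS
  let _ : CommRing (Algebra.adjoin ℚ S) :=
    { (inferInstance : Ring (Algebra.adjoin ℚ S)) with mul_comm := hc.is_comm.comm }
  let ψ : MvPolynomial ℕ ℚ →ₐ[ℚ] Algebra.adjoin ℚ S := MvPolynomial.aeval fun k =>
    (⟨(ncE P (k + 1) : I.ringCon.Quotient), Algebra.subset_adjoin ⟨k, rfl⟩⟩ : Algebra.adjoin ℚ S)
  let χ : MvPolynomial ℕ ℚ →ₐ[ℚ] I.ringCon.Quotient := (Algebra.adjoin ℚ S).val.comp ψ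
  have hX : ∀ k, esymmEquiv ℚ (MvPolynomial.X k) = esymm ℚ (k + 1) := fun k =>
    MvPolynomial.aeval_X _ k
  refine ⟨χ.comp (esymmEquiv ℚ).symm.toAlgHom, ?_, ?_⟩
  · intro k hk
    obtain ⟨k, rfl⟩ := Nat.exists_eq_add_of_le' hk
    rw [← hX, AlgHom.comp_apply]
    have : (esymmEquiv ℚ).symm.toAlgHom (esymmEquiv ℚ (MvPolynomial.X k)) = MvPolynomial.X k :=
      (esymmEquiv ℚ).symm_apply_apply _
    rw [this]
    change ((ψ (MvPolynomial.X k) : Algebra.adjoin ℚ S) : I.ringCon.Quotient) = _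
    rw [MvPolynomial.aeval_X]
  · intro φ hφ
    have h2 : φ.comp (esymmEquiv ℚ).toAlgHom = χ := by
      ext1 k
      rw [AlgHom.comp_apply]
      change φ (esymmEquiv ℚ (MvPolynomial.X k)) =
        ((ψ (MvPolynomial.X k) : Algebra.adjoin ℚ S) : I.ringCon.Quotient)
      rw [hX, hφ _ (by omega), MvPolynomial.aeval_X]
    rw [← h2]
    ext f
    change φ f = φ (esymmEquiv ℚ ((esymmEquiv ℚ).symm f))
    rw [AlgEquiv.apply_symm_apply]

/-- The algebra homomorphism `φ^P : Sym → U / I` with `e_k ↦ e^P_k(u)` for `k ≥ 1`. -/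
def phiP {N : ℕ} {P : PartialOrder (Fin N)} {I : TwoSidedIdeal (U N)}
    (hI : SatisfiesPCommutation P I) : Sym ℚ →ₐ[ℚ] I.ringCon.Quotient :=
  (exists_phiP hI).choose

theorem phiP_esymm {N : ℕ} {P : PartialOrder (Fin N)} {I : TwoSidedIdeal (U N)}
    (hI : SatisfiesPCommutation P I) (k : ℕ) (hk : 1 ≤ k) :
    phiP hI (esymm ℚ k) = (ncE P k : I.ringCon.Quotient) :=
  (exists_phiP hI).choose_spec.1 k hk

end NCSym
end

/-! Modulo `I` the noncommutative series `Ω^P` is the image under `φ^P` of the Cauchy kernel `∑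
m_λ(x) h_λ`, and the theorem is the adjunction between multiplication and skewing read through that
kernel.

Since `φ^P` is an algebra homomorphism and the recursion defining `ncH` is the one expressing the
`h_k` of `Sym` through the `e_k`, `φ^P` sends `h_k` to the class of `ncH P k` (`phiP_hsymm`). The
coefficient of `x^d` in `Ω^P` is the ordered product of the `ncH P (d i)`, so its class is `φ^P` of
the commutative product `h_d` of the `h_{d i}` (`phiP_hProd`).

As `γ` annihilates `I`, pairing with `γ` factors through the quotient and gives a functional `L(g) =
⟨φ^P(g), γ⟩` on `Sym ℚ` (`phiPair`). Thus the coefficient of `x^d` in `F^P_γ` is `L(h_d)`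
(`coeff_FP`). It depends only on the nonzero exponents up to order, whence the symmetry. Boundedness
of degree is a matter of grading: that coefficient of `Ω^P` is homogeneous of degree `|d|`, while
`γ` involves finitely many words (`hasBoundedDegree_FP`).

By duality of the `m_λ` and the `h_λ`, `⟨F^P_γ, g⟩ = L(g)` for every rational `g`
(`hall_extendCoeff`). The coefficient of `x^d` in `f^⊥ F^P_γ` is then `⟨F^P_γ, f h_d⟩ = L(f h_d)`
(`coeff_skew`), and `φ^P(f h_d)` is represented by `fP` times the `x^d`-coefficient of `Ω^P`. -/

namespace NCSym

/-! ### Pairing with `γ ∈ I^⊥` as a functional on symmetric functions -/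

section Pairing

variable {N : ℕ} {K : Type*} [CommRing K] [Algebra ℚ K]

theorem wordCoeff_add (w : FreeMonoid (Fin N)) (y z : U N) :
    wordCoeff w (y + z) = wordCoeff w y + wordCoeff w z := by
  rw [wordCoeff, map_add]; rfl

/-- The pairing `⟨·, γ⟩` as an additive map. -/
noncomputable def pairHom (γ : FreeMonoid (Fin N) →₀ K) : U N →+ K :=
  AddMonoidHom.mk' (fun z => pair z γ) fun y z => by
    simp only [pair, wordCoeff_add, map_add, add_mul, Finsupp.sum_add]

theorem pairHom_apply (γ : FreeMonoid (Fin N) →₀ K) (z : U N) : pairHom γ z = pair z γ := rfl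

/-- Two representatives of a class differ by an element of `I`, which `γ` annihilates; so the
pairing descends to `U / I`. -/
theorem pair_eq_of_coe_eq {I : TwoSidedIdeal (U N)} {γ : FreeMonoid (Fin N) →₀ K}
    (hγ : γ ∈ perp I K) {y z : U N}
    (h : (y : I.ringCon.Quotient) = (z : I.ringCon.Quotient)) : pair y γ = pair z γ := by
  rw [RingCon.eq, TwoSidedIdeal.rel_iff] at h
  have h1 := hγ _ h
  rwa [← pairHom_apply, map_sub, sub_eq_zero] at h1

theorem coe_surjective (I : TwoSidedIdeal (U N)) :
    Function.Surjective ((↑) : U N → I.ringCon.Quotient) := Quotient.mk_surjective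

/-- The functional `g ↦ ⟨φ^P(g), γ⟩` on symmetric functions, for `γ ∈ I^⊥`. -/
noncomputable def phiPair {P : PartialOrder (Fin N)} {I : TwoSidedIdeal (U N)} (hI : SatisfiesPCommutation P I)
    {γ : FreeMonoid (Fin N) →₀ K} (hγ : γ ∈ perp I K) : Sym ℚ →+ K :=
  -- `surjInv` picks an arbitrary lift of `φ^P(g)`. The lifts are not additive in `g`, but they are
  -- so modulo `I`, which is all that `γ` sees.
  AddMonoidHom.mk' (fun g => pair (Function.surjInv (coe_surjective I) (phiP hI g)) γ) fun a b => by
    rw [← pairHom_apply γ (Function.surjInv _ (phiP hI a)),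
      ← pairHom_apply γ (Function.surjInv _ (phiP hI b)), ← map_add, pairHom_apply]
    refine pair_eq_of_coe_eq hγ ?_
    rw [RingCon.coe_add]
    simp only [Function.surjInv_eq, map_add]

/-- Removes the arbitrary lift from the definition of `phiPair`: any representative of `φ^P(g)` may
be used. -/
theorem phiPair_eq {P : PartialOrder (Fin N)} {I : TwoSidedIdeal (U N)}
    (hI : SatisfiesPCommutation P I) {γ : FreeMonoid (Fin N) →₀ K} (hγ : γ ∈ perp I K)
    {g : Sym ℚ} {z : U N} (h : (z : I.ringCon.Quotient) = phiP hI g) :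
    phiPair hI hγ g = pair z γ :=
  pair_eq_of_coe_eq hγ ((Function.surjInv_eq (coe_surjective I) _).trans h.symm)

end Pairing

/-! ### Coefficients of `Ω^P` as images of products of complete homogeneous functions -/

section Complete

variable {N : ℕ} {P : PartialOrder (Fin N)} {I : TwoSidedIdeal (U N)}

/-- Both sides obey the same recursion in the elementary elements, with the same initial value 1.
Only `e_{i+1}` occurs in it, so the values of `φ^P` on `e_k` with `k ≥ 1` suffice. -/
theorem phiP_hsymm (hI : SatisfiesPCommutation P I) (k : ℕ) :
    phiP hI (hsymm ℚ k) = (ncH P k : I.ringCon.Quotient) := by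
  induction k using Nat.strong_induction_on with
  | _ k ih =>
    cases k with
    | zero => rw [hsymm_zero, map_one, ncH, RingCon.coe_one]
    | succ n =>
      rw [hsymm_succ, map_sum, ncH,
        Finset.sum_range fun i => phiP hI ((-1) ^ i * (esymm ℚ (i + 1) * hsymm ℚ (n - i)))]
      -- The coercion to the quotient is restated as a ring homomorphism, so that it can be pushed
      -- through sums and products.
      change _ = I.ringCon.mk' _
      rw [map_sum]
      refine Finset.sum_congr rfl fun i _ => ?_
      rw [map_mul, map_mul, ih (n - i) (by omega), phiP_esymm hI _ (by omega), map_mul, map_mul,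
        map_pow, map_neg, map_one, map_pow, map_neg, map_one]
      rfl

/-- The factors on the `U` side come in the order of the variables; in `Sym` the product commutes
and can be listed in that same order, after which the factors match one by one. -/
theorem phiP_hProd (hI : SatisfiesPCommutation P I) (d : ℕ →₀ ℕ) :
    phiP hI (hProd ℚ d) =
      ((MvPowerSeries.coeff d (Omega P) : U N) : I.ringCon.Quotient) := by
  have hd : ∀ i ∈ d.support, i < d.support.sup id + 1 := fun i hi =>
    Nat.lt_succ_of_le (Finset.le_sup (f := id) hi)
  -- Any strict bound on the support will do: indices below `n` outside the support contribute the
  -- factor `h_0 = 1`.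
  generalize d.support.sup id + 1 = n at hd
  rw [coeff_Omega P d n hd, coeff_partialOmega, if_pos hd]
  have h1 : hProd ℚ d = ((List.range n).map fun i => hsymm ℚ (d i)).prod := by
    rw [hProd, Finsupp.prod_of_support_subset d (s := Finset.range n)
      (fun i hi => Finset.mem_range.2 (hd i hi)) _ fun i _ => hsymm_zero ℚ]
    rfl
  change _ = I.ringCon.mk' _
  rw [h1, map_list_prod, map_list_prod, List.map_map, List.map_map]
  congr 1
  exact List.map_congr_left fun i _ => phiP_hsymm hI (d i)

end Complete

/-! ### The grading of the free algebra and the bound on the degree of `F^P_γ` -/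

section Degree

variable {N : ℕ}

/-- The homogeneous elements of degree `k` of the free algebra. -/
noncomputable def homogeneousPart (N k : ℕ) : Submodule ℚ (U N) :=
  Submodule.span ℚ (Set.range (FreeAlgebra.ι ℚ)) ^ k

theorem wordCoeff_eq_zero {k : ℕ} {z : U N} (hz : z ∈ homogeneousPart N k)
    {w : FreeMonoid (Fin N)} (hw : w.length ≠ k) : wordCoeff w z = 0 := by
  -- The power of the span becomes the span of the `k`-fold products of generators, so only words of
  -- length `k` have to be examined.
  rw [homogeneousPart, Submodule.span_pow] at hz
  induction hz using Submodule.span_induction with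
  | mem z h =>
    obtain ⟨g, rfl⟩ := Set.mem_pow.1 h
    choose v hv using fun i => (g i).2
    have h1 : (List.ofFn fun i => (g i : U N)) = (List.ofFn v).map (FreeAlgebra.ι ℚ) := by
      rw [List.map_ofFn]
      congr 1
      funext i
      exact (hv i).symm
    -- In the monoid algebra a product of generators is the basis element of its word, and its other
    -- coefficients vanish.
    have h2 : ∀ l : List (Fin N), FreeAlgebra.equivMonoidAlgebraFreeMonoid
        (l.map (FreeAlgebra.ι ℚ)).prod =
          MonoidAlgebra.single (FreeMonoid.ofList l) (1 : ℚ) := by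
      intro l
      induction l with
      | nil => rw [List.map_nil, List.prod_nil, map_one]; rfl
      | cons a l ih =>
        rw [List.map_cons, List.prod_cons, map_mul, ih, FreeMonoid.ofList_cons]
        simp [FreeAlgebra.equivMonoidAlgebraFreeMonoid, MonoidAlgebra.single_mul_single]
    rw [h1, wordCoeff, h2]
    refine Finsupp.single_eq_of_ne ?_
    rintro rfl
    apply hw
    simp [FreeMonoid.length]
  | zero => rw [wordCoeff, map_zero]; rfl
  | add y z _ _ hy hz => rw [wordCoeff_add, hy, hz, add_zero]
  | smul c z _ hz =>
    rw [wordCoeff, map_smul]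
    change c • wordCoeff w z = 0
    rw [hz, smul_zero]

theorem mul_mem_homogeneousPart {k l : ℕ} {y z : U N} (hy : y ∈ homogeneousPart N k)
    (hz : z ∈ homogeneousPart N l) : y * z ∈ homogeneousPart N (k + l) := by
  rw [homogeneousPart, pow_add]
  exact Submodule.mul_mem_mul hy hz

theorem ncE_mem (P : PartialOrder (Fin N)) (k : ℕ) : ncE P k ∈ homogeneousPart N k := by
  refine Submodule.sum_mem _ fun w _ => ?_
  rw [homogeneousPart, Submodule.span_pow]
  exact Submodule.subset_span (Set.mem_pow.2 ⟨fun i => ⟨_, w i, rfl⟩, rfl⟩)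

theorem ncH_mem (P : PartialOrder (Fin N)) (k : ℕ) : ncH P k ∈ homogeneousPart N k := by
  induction k using Nat.strong_induction_on with
  | _ k ih =>
    cases k with
    | zero =>
      rw [ncH, homogeneousPart, pow_zero]
      exact Submodule.one_le.1 le_rfl
    | succ n =>
      rw [ncH]
      refine Submodule.sum_mem _ fun i _ => ?_
      have h := mul_mem_homogeneousPart (ncE_mem P (i + 1)) (ih (n - i) (by omega))
      rw [show (i : ℕ) + 1 + (n - i) = n + 1 by omega] at h
      -- The sign is an element of the algebra, not a scalar; splitting into `1` and `-1` leaves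
      -- only closure under negation to use.
      rcases neg_one_pow_eq_or (U N) (i : ℕ) with hi | hi
      · rwa [hi, one_mul]
      · rw [hi, neg_one_mul]
        exact Submodule.neg_mem _ h

theorem coeff_Omega_mem (P : PartialOrder (Fin N)) (d : ℕ →₀ ℕ) :
    MvPowerSeries.coeff d (Omega P) ∈ homogeneousPart N d.degree := by
  have hd : ∀ i ∈ d.support, i < d.support.sup id + 1 := fun i hi =>
    Nat.lt_succ_of_le (Finset.le_sup (f := id) hi)
  generalize d.support.sup id + 1 = n at hd
  rw [coeff_Omega P d n hd, coeff_partialOmega, if_pos hd]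
  have h1 : d.degree = ((List.range n).map d).sum := by
    rw [Finsupp.degree_apply]
    change _ = ∑ i ∈ Finset.range n, d i
    exact Finset.sum_subset (fun i hi => Finset.mem_range.2 (hd i hi))
      fun i _ hi => Finsupp.notMem_support_iff.1 hi
  rw [h1]
  -- The degree is now a sum and the coefficient a product over the same list, so the claim holds
  -- for an arbitrary list of indices.
  induction List.range n with
  | nil =>
    rw [List.map_nil, List.map_nil, List.prod_nil, List.sum_nil, homogeneousPart, pow_zero]
    exact Submodule.one_le.1 le_rfl
  | cons a l ih => exact mul_mem_homogeneousPart (ncH_mem P (d a)) ih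

/-- The bound is the length of the longest word in `γ`: beyond it, the coefficient of `Ω^P` is
homogeneous of a degree in which `γ` has no word. -/
theorem hasBoundedDegree_FP {K : Type*} [CommRing K] [Algebra ℚ K] (P : PartialOrder (Fin N))
    (γ : FreeMonoid (Fin N) →₀ K) : HasBoundedDegree (FP P γ) := by
  refine ⟨γ.support.sup FreeMonoid.length, fun d hd => ?_⟩
  refine Finset.sum_eq_zero fun w hw => ?_
  have := Finset.le_sup (f := FreeMonoid.length) hw
  beta_reduce
  rw [wordCoeff_eq_zero (coeff_Omega_mem P d) (by omega), map_zero, zero_mul]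

end Degree

/-! ### Symmetry of `F^P_γ`, its Hall pairing, and the coefficients of a skewed function -/

section Skewing

variable {N : ℕ} {K : Type*} [CommRing K] [Algebra ℚ K] {P : PartialOrder (Fin N)}
  {I : TwoSidedIdeal (U N)}

theorem coeff_FP (hI : SatisfiesPCommutation P I) {γ : FreeMonoid (Fin N) →₀ K}
    (hγ : γ ∈ perp I K) (d : ℕ →₀ ℕ) :
    MvPowerSeries.coeff d (FP P γ) = phiPair hI hγ (hProd ℚ d) :=
  (phiPair_eq hI hγ (phiP_hProd hI d).symm).symm

/-- Permuting the variables permutes the exponents, which leaves the product of the `h_{d i}`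
unchanged; `coeff_FP` turns this into symmetry. -/
theorem FP_mem_Sym (hI : SatisfiesPCommutation P I) {γ : FreeMonoid (Fin N) →₀ K}
    (hγ : γ ∈ perp I K) : FP P γ ∈ Sym K := by
  refine ⟨(isSymm_iff _).2 fun σ d => ?_, hasBoundedDegree_FP P γ⟩
  rw [coeff_FP hI hγ, coeff_FP hI hγ, hProd_eq, hProd_eq, parts_embDomain]

theorem extendCoeff_add (f g : Sym ℚ) :
    extendCoeff K (f + g) = extendCoeff K f + extendCoeff K g :=
  Subtype.ext (map_add (MvPowerSeries.map (algebraMap ℚ K)) _ _)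

theorem extendCoeff_mul (f g : Sym ℚ) :
    extendCoeff K (f * g) = extendCoeff K f * extendCoeff K g :=
  Subtype.ext (map_mul (MvPowerSeries.map (algebraMap ℚ K)) _ _)

theorem extendCoeff_one : extendCoeff K (1 : Sym ℚ) = 1 :=
  Subtype.ext (map_one (MvPowerSeries.map (algebraMap ℚ K)))

theorem extendCoeff_hsymm (k : ℕ) : extendCoeff K (hsymm ℚ k) = hsymm K k := by
  apply Subtype.ext
  ext d
  change algebraMap ℚ K (if d.degree = k then 1 else 0) = if d.degree = k then 1 else 0
  split_ifs <;> simp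

/-- Needed because `φ^P` lives on `Sym ℚ` while the Hall pairing with `F^P_γ` is taken over `K`. -/
theorem extendCoeff_hProd (d : ℕ →₀ ℕ) : extendCoeff K (hProd ℚ d) = hProd K d := by
  rw [hProd, hProd, Finsupp.prod, Finsupp.prod]
  induction d.support using Finset.cons_induction with
  | empty => exact extendCoeff_one
  | cons a s ha ih => rw [Finset.prod_cons, Finset.prod_cons, extendCoeff_mul, extendCoeff_hsymm, ih]

theorem hProd_expo (R : Type*) [CommRing R] (s : ℕ →₀ ℕ) : hProd R (expo s) = hBasis R s := by
  rw [hProd_eq, parts_expo]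

/-- Both sides are additive in `g`, hence `ℚ`-linear, so it is enough to compare them on the basis
`h_λ`. There the Hall pairing reads off the coefficient of `x^λ` in `F^P_γ`, which `coeff_FP`
computes. -/
theorem hall_extendCoeff (hI : SatisfiesPCommutation P I) {γ : FreeMonoid (Fin N) →₀ K}
    (hγ : γ ∈ perp I K) (g : Sym ℚ) :
    hall K ⟨FP P γ, FP_mem_Sym hI hγ⟩ (extendCoeff K g) = phiPair hI hγ g := by
  let A : Sym ℚ →+ K := AddMonoidHom.mk'
    (fun g => hall K ⟨FP P γ, FP_mem_Sym hI hγ⟩ (extendCoeff K g)) fun a b => by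
      rw [extendCoeff_add, map_add]
  have h : A.toRatLinearMap = (phiPair hI hγ).toRatLinearMap := by
    refine (hBasis ℚ).ext fun s => ?_
    change hall K _ (extendCoeff K (hBasis ℚ s)) = phiPair hI hγ (hBasis ℚ s)
    rw [← hProd_expo, extendCoeff_hProd, hProd_expo, hall_hBasis, coeff_FP hI hγ]
  exact DFunLike.congr_fun h g

/-- A coefficient of a symmetric function is its Hall pairing with the corresponding `h_λ`; the
defining adjunction of `skew` then moves `a` across. -/
theorem coeff_skew {R : Type*} [CommRing R] (a F : Sym R) (d : ℕ →₀ ℕ) :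
    MvPowerSeries.coeff d (skew a F : MvPowerSeries ℕ R) = hall R F (a * hProd R d) := by
  -- `hall_hBasis` only reads coefficients at weakly decreasing exponent vectors, so `d` is first
  -- sorted by a permutation.
  obtain ⟨σ, hσ⟩ := exists_perm_of_parts_eq d (expo (parts d)) (parts_expo _).symm
  rw [← (isSymm_iff _).1 (skew a F).2.1 σ, hσ, ← hall_hBasis, hall_skew, ← hProd_eq]

end Skewing

end NCSym

/-! ### The skewing formula -/

theorem mainTheorem5 {N : ℕ} (P : PartialOrder (Fin N)) (I : TwoSidedIdeal (NCSym.U N))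
    (hI : NCSym.SatisfiesPCommutation P I)
    {K : Type*} [CommRing K] [Algebra ℚ K]
    (γ : FreeMonoid (Fin N) →₀ K) (hγ : γ ∈ NCSym.perp I K)
    (f : NCSym.Sym ℚ) (fP : NCSym.U N)
    (hfP : (fP : I.ringCon.Quotient) = NCSym.phiP hI f) :
    ∃ hF : NCSym.FP P γ ∈ NCSym.Sym K,
      (NCSym.skew (NCSym.extendCoeff K f) ⟨NCSym.FP P γ, hF⟩ : MvPowerSeries ℕ K) =
        NCSym.pairSeries (MvPowerSeries.C fP * NCSym.Omega P) γ := by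
  refine ⟨NCSym.FP_mem_Sym hI hγ, ?_⟩
  ext d
  -- `f h_d` is recognised as a rational symmetric function, so its pairing with `F^P_γ` is the
  -- value of `phiPair`.
  rw [NCSym.coeff_skew, ← NCSym.extendCoeff_hProd, ← NCSym.extendCoeff_mul,
    NCSym.hall_extendCoeff hI hγ]
  change _ = NCSym.pair (MvPowerSeries.coeff d (MvPowerSeries.C fP * NCSym.Omega P)) γ
  rw [MvPowerSeries.coeff_C_mul]
  -- By multiplicativity of `φ^P`, the product of `fP` with the `x^d`-coefficient of `Ω^P`
  -- represents `φ^P(f h_d)`.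
  refine NCSym.phiPair_eq hI hγ ?_
  rw [RingCon.coe_mul, hfP, map_mul, NCSym.phiP_hProd]
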